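/- Let $\mu\ge 0$, $\delta>0$ and $\epsilon>0$. For $j\in\{1,2\}$ let $A_j=(\ln(I-\Delta))^\mu\,\partial_{x_j}$ be the Fourier multiplier on $\mathbb{R}^2$ with symbol $i\xi_j\,(\ln(1+|\xi|^2))^\mu$ (with respect to $\widehat u(\xi)=\int e^{-ix\cdot\xi}u(x)\,dx$). For $s>0$ put $$\|g\|_{H^s}=\|(I-\Delta)^{s/2}g\|_{L^2},\qquad \|f\|_{\dot H^s}=\|(-\Delta)^{s/2}f\|_{L^2}.$$ Then there is a constant $C_{\mu,\epsilon,\delta}$, depending only on $\mu$, $\epsilon$ and $\delta$, such that for every $j\in\{1,2\}$, every $f\in L^2(\mathbb{R}^2)$ with $\|f\|_{\dot H^\delta}<\infty$ and every $g\in H^{2+3\epsilon}(\mathbb{R}^2)$ (real- or complex-valued), the commutator $$[A_j,g]f=A_j(fg)-(A_jf)\,g,$$ which is well defined as a tempered distribution, with the product given by $\langle (A_jf)\,g,\varphi\rangle=\langle A_jf,g\varphi\rangle$ for Schwartz functions $\varphi$, belongs to $L^2(\mathbb{R}^2)$ and satisfies $$\big\|[A_j,g]f\big\|_{L^2}\le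 C_{\mu,\epsilon,\delta}\left(1+\left(\ln\left(1+\frac{\|f\|_{\dot H^\delta}}{\|f\|_{L^2}}\right)\right)^{\mu}\right)\|f\|_{L^2}\,\|g\|_{H^{2+3\epsilon}}.$$ Here the right-hand side is read as $0$ when $f=0$, and $t^0=1$ for all $t\ge 0$. -/

import Mathlib

open MeasureTheory FourierTransform
open scoped SchwartzMap

noncomputable section

namespace LogCommutator

/-- The Euclidean plane. -/
abbrev Plane : Type := EuclideanSpace ℝ (Fin 2)

/-- Complex-valued square-integrable functions on the plane. -/
abbrev L2 : Type := Lp ℂ 2 (volume : Measure Plane)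

/-- The function whose `L²` norm is the homogeneous Sobolev norm of order `δ`. The Fourier transform
used here is `𝓕 f (ξ) = ∫ exp (-2πi x·ξ) f x dx`, so that `(-Δ) ^ (δ / 2)` has the symbol
`(2π‖ξ‖) ^ δ`. -/
def homDensity (δ : ℝ) (f : L2) (ξ : Plane) : ℂ :=
  (((2 * Real.pi * ‖ξ‖) ^ δ : ℝ) : ℂ) * (𝓕 f : L2) ξ

/-- Membership of a square-integrable function in the homogeneous Sobolev space of order `δ`. -/
def MemHomSobolev (δ : ℝ) (f : L2) : Prop :=
  MemLp (homDensity δ f) 2 volume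

/-- The homogeneous Sobolev norm of order `δ`. -/
def homSobolevNorm (δ : ℝ) (f : L2) : ℝ :=
  (eLpNorm (homDensity δ f) 2 volume).toReal

/-- The inhomogeneous Sobolev norm of order `s`, that is the `L²` norm of
`(I - Δ) ^ (s / 2) g`. It is finite exactly when `TemperedDistribution.MemSobolev s 2 g` holds. -/
def sobolevNorm (s : ℝ) (g : L2) : ℝ :=
  (eLpNorm (fun ξ : Plane ↦
    (((1 + (2 * Real.pi * ‖ξ‖) ^ 2) ^ (s / 2) : ℝ) : ℂ) * (𝓕 g : L2) ξ) 2 volume).toReal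

/-- The symbol of the Fourier multiplier `(ln (I - Δ)) ^ μ ∂_{x_j}`. -/
def symbol (μ : ℝ) (j : Fin 2) (ξ : Plane) : ℂ :=
  ((Real.log (1 + (2 * Real.pi * ‖ξ‖) ^ 2) ^ μ : ℝ) : ℂ) *
    (2 * Real.pi * Complex.I * (ξ j : ℂ))

/-- The transpose `ψ ↦ 𝓕 (m · 𝓕⁻ ψ)` of the multiplier `A : u ↦ 𝓕⁻ (m · 𝓕 u)` with
`m = symbol μ j`, for the bilinear pairing `∫ u ψ`. -/
def transposeOp (μ : ℝ) (j : Fin 2) (ψ : Plane → ℂ) : Plane → ℂ :=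
  𝓕 (fun ξ : Plane ↦ symbol μ j ξ * (𝓕⁻ ψ : Plane → ℂ) ξ)

/-- All the integrals in the pairing of `A u`, for `A = (ln (I - Δ)) ^ μ ∂_{x_j}`, with the
function `ψ` converge absolutely. -/
structure CanPair (μ : ℝ) (j : Fin 2) (u ψ : Plane → ℂ) : Prop where
  integrable_test : Integrable ψ volume
  integrable_symbol : Integrable (fun ξ : Plane ↦ symbol μ j ξ * (𝓕⁻ ψ : Plane → ℂ) ξ) volume
  integrable_pair : Integrable (fun x : Plane ↦ u x * transposeOp μ j ψ x) volume

/-- The distributional pairing `⟨A u, ψ⟩` for `A = (ln (I - Δ)) ^ μ ∂_{x_j}`. -/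
def pairing (μ : ℝ) (j : Fin 2) (u ψ : Plane → ℂ) : ℂ :=
  ∫ x, u x * transposeOp μ j ψ x

/-- The tempered distribution `A (f g) - (A f) g`, with `A = (ln (I - Δ)) ^ μ ∂_{x_j}`, is well
defined and equals the square-integrable function `h`. The product of the distribution `A f` with
the function `g` is `⟨(A f) g, φ⟩ = ⟨A f, g φ⟩`. -/
structure IsCommutator (μ : ℝ) (j : Fin 2) (g f h : L2) : Prop where
  canPair_mul : ∀ φ : 𝓢(Plane, ℂ), CanPair μ j (fun x ↦ f x * g x) φ
  canPair_left : ∀ φ : 𝓢(Plane, ℂ), CanPair μ j f (fun x ↦ g x * φ x)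
  eq : ∀ φ : 𝓢(Plane, ℂ), ∫ x, h x * φ x =
    pairing μ j (fun x ↦ f x * g x) φ - pairing μ j f (fun x ↦ g x * φ x)

end LogCommutator

end

/-! Write `m` for the symbol of `A` and `w = 1 + (ln (1 + |ξ|²)) ^ μ`. On the Fourier side the
commutator is the integral operator `ξ ↦ ∫ ĝ(ξ - η) (m(ξ) - m(η)) f̂(η) dη`. The mean value theorem
gives `|m(ξ) - m(η)| ≤ C (1 + |ξ - η|) w(ξ - η) w(η)` (`norm_symbol_sub_le`): the full derivative
falls on `g`, and `f` only pays a logarithm. Young's inequality `L¹ * L² ⊆ L²` then bounds the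
commutator by `‖(1 + |k|) w ĝ‖_{L¹} ‖w f̂‖_{L²}`.

The `L¹` factor is bounded by the Sobolev norm of `g` through Cauchy–Schwarz against `(1 + |k|²) ^
(-(1 + ε) / 2)`, which is square-integrable in dimension two. For the `L²` factor put `X = ‖f‖_{Ḣ^δ}
/ ‖f‖`; then `w(ξ) ≤ C (1 + ln(1 + X) ^ μ + |ξ| ^ δ / (1 + X))` (`exists_logWeight_le`), and the
last term contributes at most `‖f‖`.

The commutator itself is defined by duality. Both pairings are turned by Parseval into absolutely
convergent double integrals of `f̂` against convolutions (`canPair_mul`, `canPair_left`); their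
difference, after Fubini, is the kernel above (`exists_isCommutator`). -/

namespace LogCommutator

/-! ### Compatibility of the `L²` Fourier transform with Fourier integrals, and Parseval -/

section Fourier

variable {E : Type*} [NormedAddCommGroup E] [InnerProductSpace ℝ E] [FiniteDimensional ℝ E]
  [MeasurableSpace E] [BorelSpace E]

theorem integral_fourier_mul_eq {u v : E → ℂ} (hu : Integrable u) (hv : Integrable v) :
    ∫ x, 𝓕 u x * v x = ∫ x, u x * 𝓕 v x := by
  simpa using! VectorFourier.integral_bilin_fourierIntegral_eq_flip (ContinuousLinearMap.mul ℂ ℂ)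
    (L := innerₗ E) (μ := volume) (ν := volume) Real.continuous_fourierChar continuous_inner hu hv

/-- On `L¹ ∩ L²`, the `L²` Fourier transform is the Fourier integral. -/
theorem fourier_toLp_ae_eq {u : E → ℂ} (h1 : Integrable u) (h2 : MemLp u 2 volume) :
    ((𝓕 (h2.toLp u) : Lp ℂ 2 (volume : Measure E)) : E → ℂ) =ᵐ[volume] 𝓕 u := by
  have hcont : Continuous (𝓕 u) :=
    VectorFourier.fourierIntegral_continuous Real.continuous_fourierChar continuous_inner h1
  refine ae_eq_of_integral_contDiff_smul_eq ((Lp.memLp _).locallyIntegrable (by norm_num))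
    hcont.locallyIntegrable fun g hg hgc ↦ ?_
  have hg₁ : HasCompactSupport (Complex.ofRealCLM ∘ g) := hgc.comp_left rfl
  have hg₂ : ContDiff ℝ (⊤ : ℕ∞) (Complex.ofRealCLM ∘ g) := by fun_prop
  set φ : 𝓢(E, ℂ) := hg₁.toSchwartzMap hg₂
  have hφ : ∀ x, φ x = (g x : ℂ) := fun x ↦ by simp [φ]
  have key := DFunLike.congr_fun (Lp.fourier_toTemperedDistribution_eq (h2.toLp u)) φ
  rw [TemperedDistribution.fourier_apply, Lp.toTemperedDistribution_apply,
    Lp.toTemperedDistribution_apply] at key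
  simp only [hφ, smul_eq_mul] at key
  simp only [Complex.real_smul]
  rw [← key]
  calc ∫ x, (𝓕 φ) x * (h2.toLp u) x = ∫ x, 𝓕 (φ : E → ℂ) x * u x := by
        refine integral_congr_ae ?_
        filter_upwards [h2.coeFn_toLp] with x hx
        rw [hx, SchwartzMap.fourier_coe]
    _ = ∫ x, φ x * 𝓕 u x := integral_fourier_mul_eq φ.integrable h1
    _ = _ := by simp only [hφ]

theorem memLp_two_fourier {u : E → ℂ} (h1 : Integrable u) (h2 : MemLp u 2 volume) :
    MemLp (𝓕 u) 2 volume :=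
  (Lp.memLp (𝓕 (h2.toLp u) : Lp ℂ 2 (volume : Measure E))).ae_eq (fourier_toLp_ae_eq h1 h2)

/-- On `L¹ ∩ L²`, the inverse `L²` Fourier transform is the inverse Fourier integral. -/
theorem fourierInv_toLp_ae_eq {u : E → ℂ} (h1 : Integrable u) (h2 : MemLp u 2 volume) :
    ((𝓕⁻ (h2.toLp u) : Lp ℂ 2 (volume : Measure E)) : E → ℂ) =ᵐ[volume] 𝓕⁻ u := by
  have hcont : Continuous (𝓕⁻ u) := by
    have : 𝓕⁻ u = fun x ↦ 𝓕 u (-x) := funext fun x ↦ Real.fourierInv_eq_fourier_neg u x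
    rw [this]
    exact (VectorFourier.fourierIntegral_continuous Real.continuous_fourierChar continuous_inner
      h1).comp continuous_neg
  refine ae_eq_of_integral_contDiff_smul_eq ((Lp.memLp _).locallyIntegrable (by norm_num))
    hcont.locallyIntegrable fun g hg hgc ↦ ?_
  have hg₁ : HasCompactSupport (Complex.ofRealCLM ∘ g) := hgc.comp_left rfl
  have hg₂ : ContDiff ℝ (⊤ : ℕ∞) (Complex.ofRealCLM ∘ g) := by fun_prop
  set φ : 𝓢(E, ℂ) := hg₁.toSchwartzMap hg₂
  have hφ : ∀ x, φ x = (g x : ℂ) := fun x ↦ by simp [φ]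
  have key := DFunLike.congr_fun (Lp.fourierInv_toTemperedDistribution_eq (h2.toLp u)) φ
  rw [TemperedDistribution.fourierInv_apply, Lp.toTemperedDistribution_apply,
    Lp.toTemperedDistribution_apply] at key
  simp only [hφ, smul_eq_mul] at key
  simp only [Complex.real_smul]
  rw [← key]
  calc ∫ x, (𝓕⁻ φ) x * (h2.toLp u) x = ∫ x, 𝓕 (φ : E → ℂ) (-x) * u x := by
        refine integral_congr_ae ?_
        filter_upwards [h2.coeFn_toLp] with x hx
        rw [hx, SchwartzMap.fourierInv_coe, Real.fourierInv_eq_fourier_neg]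
    _ = ∫ x, 𝓕 (φ : E → ℂ) x * u (-x) := by
        rw [← integral_neg_eq_self]
        simp
    _ = ∫ x, φ x * 𝓕 (fun x ↦ u (-x)) x := integral_fourier_mul_eq φ.integrable h1.comp_neg
    _ = _ := by simp only [hφ, Real.fourierInv_eq_fourier_comp_neg]

/-- The bilinear Parseval identity on `L²`. -/
theorem integral_fourier_mul_eq_of_Lp (u v : Lp ℂ 2 (volume : Measure E)) :
    ∫ x, (𝓕 u : Lp ℂ 2 (volume : Measure E)) x * v x =
      ∫ x, u x * (𝓕 v : Lp ℂ 2 (volume : Measure E)) x := by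
  let B : Lp ℂ 2 (volume : Measure E) →L[ℂ] Lp ℂ 2 (volume : Measure E) →L[ℂ] ℂ :=
    (ContinuousLinearMap.mul ℂ ℂ).lpPairing volume 2 2
  have hB : ∀ a b, B a b = ∫ x, a x * b x := fun a b ↦ by
    simp [B, ContinuousLinearMap.lpPairing_eq_integral]
  simp only [← hB]
  refine DenseRange.induction_on (p := fun v ↦ B (𝓕 u) v = B u (𝓕 v))
    (SchwartzMap.denseRange_toLpCLM (F := ℂ) (p := 2) ENNReal.ofNat_ne_top) v ?_ fun φ ↦ ?_
  · exact isClosed_eq (B (𝓕 u)).continuous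
      ((B u).continuous.comp (FourierTransform.continuous_fourier))
  · have key := DFunLike.congr_fun (Lp.fourier_toTemperedDistribution_eq u) φ
    rw [TemperedDistribution.fourier_apply, Lp.toTemperedDistribution_apply,
      Lp.toTemperedDistribution_apply] at key
    rw [hB, hB]
    simp only [smul_eq_mul, SchwartzMap.toLpCLM_apply] at key ⊢
    rw [SchwartzMap.toLp_fourier_eq]
    calc _ = ∫ x, φ x * (𝓕 u : Lp ℂ 2 (volume : Measure E)) x := by
          refine integral_congr_ae ?_
          filter_upwards [φ.coeFn_toLp 2 volume] with x hx
          rw [hx, mul_comm]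
      _ = _ := key.symm
      _ = _ := by
          refine integral_congr_ae ?_
          filter_upwards [(𝓕 φ).coeFn_toLp 2 volume] with x hx
          rw [hx, mul_comm]

/-- Parseval in mixed form: `u` is only an `L²` class, while the transform of `v` is a genuine
integral, as in `transposeOp`. Both pairings of the commutator are evaluated with it. -/
theorem integral_mul_fourier_eq (u : Lp ℂ 2 (volume : Measure E)) {v : E → ℂ}
    (h1 : Integrable v) (h2 : MemLp v 2 volume) :
    ∫ x, u x * 𝓕 v x = ∫ x, (𝓕 u : Lp ℂ 2 (volume : Measure E)) x * v x := by
  calc _ = ∫ x, u x * (𝓕 (h2.toLp v) : Lp ℂ 2 (volume : Measure E)) x := by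
        refine integral_congr_ae ?_
        filter_upwards [fourier_toLp_ae_eq h1 h2] with x hx
        rw [hx]
    _ = _ := (integral_fourier_mul_eq_of_Lp _ _).symm
    _ = _ := by
        refine integral_congr_ae ?_
        filter_upwards [h2.coeFn_toLp] with x hx
        rw [hx]

/-- Fourier inversion on `L¹ ∩ L²`. -/
theorem fourierInv_fourier_ae_eq {u : E → ℂ} (h1 : Integrable u) (h2 : MemLp u 2 volume)
    (h3 : Integrable (𝓕 u)) : 𝓕⁻ (𝓕 u) =ᵐ[volume] u := by
  have h4 := memLp_two_fourier h1 h2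
  have h5 : h4.toLp (𝓕 u) = 𝓕 (h2.toLp u) :=
    Lp.ext (h4.coeFn_toLp.trans (fourier_toLp_ae_eq h1 h2).symm)
  have h6 := fourierInv_toLp_ae_eq h3 h4
  rw [h5, FourierTransform.fourierInv_fourier_eq] at h6
  exact h6.symm.trans h2.coeFn_toLp

/-- An `L²` function with integrable Fourier transform is a Fourier integral. -/
theorem ae_eq_fourier_of_integrable (g : Lp ℂ 2 (volume : Measure E))
    (hg : Integrable (𝓕 g : Lp ℂ 2 (volume : Measure E))) :
    g =ᵐ[volume] 𝓕 (fun ξ ↦ (𝓕 g : Lp ℂ 2 (volume : Measure E)) (-ξ)) := by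
  have h := fourierInv_toLp_ae_eq hg (Lp.memLp _)
  rw [Lp.toLp_coeFn, FourierTransform.fourierInv_fourier_eq,
    Real.fourierInv_eq_fourier_comp_neg] at h
  exact h

end Fourier

/-! ### Integral operators with kernels dominated by convolutions -/

section Kernel

open scoped ENNReal

variable {E : Type*} [NormedAddCommGroup E] [InnerProductSpace ℝ E] [FiniteDimensional ℝ E]
  [MeasurableSpace E] [BorelSpace E]

theorem sq_lintegral_mul_le {α : Type*} [MeasurableSpace α] (ν : Measure α) {f g : α → ℝ≥0∞}
    (hf : Measurable f) (hg : Measurable g) :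
    (∫⁻ a, f a * g a ∂ν) ^ 2 ≤ (∫⁻ a, f a ^ 2 ∂ν) * ∫⁻ a, g a ^ 2 ∂ν := by
  have h := ENNReal.lintegral_mul_le_Lp_mul_Lq ν Real.HolderConjugate.two_two hf.aemeasurable
    hg.aemeasurable
  simp only [Pi.mul_apply, ENNReal.rpow_two] at h
  calc _ ≤ ((∫⁻ a, f a ^ 2 ∂ν) ^ (1 / 2 : ℝ) * (∫⁻ a, g a ^ 2 ∂ν) ^ (1 / 2 : ℝ)) ^ 2 := by gcongr
    _ = _ := by
      rw [mul_pow, ← ENNReal.rpow_natCast, ← ENNReal.rpow_natCast, ← ENNReal.rpow_mul,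
        ← ENNReal.rpow_mul]
      norm_num

/-- Cauchy--Schwarz with a weight. -/
theorem sq_lintegral_weight_mul_le {α : Type*} [MeasurableSpace α] (ν : Measure α)
    {w g : α → ℝ≥0∞} (hw : Measurable w) (hg : Measurable g) :
    (∫⁻ a, w a * g a ∂ν) ^ 2 ≤ (∫⁻ a, w a ∂ν) * ∫⁻ a, w a * g a ^ 2 ∂ν := by
  have hs : ∀ a, (w a ^ (1 / 2 : ℝ)) ^ 2 = w a := fun a ↦ by
    rw [← ENNReal.rpow_natCast, ← ENNReal.rpow_mul]
    norm_num
  have h := sq_lintegral_mul_le ν (hw.pow_const (1 / 2 : ℝ)) ((hw.pow_const (1 / 2 : ℝ)).mul hg)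
  have h1 : ∀ a, w a ^ (1 / 2 : ℝ) * (w a ^ (1 / 2 : ℝ) * g a) = w a * g a := fun a ↦ by
    rw [← mul_assoc, ← sq, hs]
  simpa only [Pi.mul_apply, mul_pow, hs, h1] using h

/-- Young's inequality `L¹ * L² ⊆ L²`. -/
theorem lintegral_sq_convolution_le {A B : E → ℝ≥0∞} (hA : Measurable A) (hB : Measurable B) :
    ∫⁻ x, (∫⁻ y, A (x - y) * B y) ^ 2 ≤ (∫⁻ x, A x) ^ 2 * ∫⁻ y, B y ^ 2 := by
  have h1 : ∀ x, ∫⁻ y, A (x - y) = ∫⁻ y, A y := fun x ↦ lintegral_sub_left_eq_self A x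
  calc _ ≤ ∫⁻ x, (∫⁻ y, A y) * ∫⁻ y, A (x - y) * B y ^ 2 := by
        refine lintegral_mono fun x ↦ ?_
        rw [← h1 x]
        exact sq_lintegral_weight_mul_le volume (by fun_prop) hB
    _ = (∫⁻ y, A y) * ∫⁻ y, ∫⁻ x, A (x - y) * B y ^ 2 := by
        rw [lintegral_const_mul, lintegral_lintegral_swap]
        · fun_prop
        · exact Measurable.lintegral_prod_right'
            (f := fun z : E × E ↦ A (z.1 - z.2) * B z.2 ^ 2) (by fun_prop)
    _ = (∫⁻ y, A y) * ∫⁻ y, (∫⁻ x, A x) * B y ^ 2 := by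
        congr 2
        ext y
        rw [lintegral_mul_const _ (by fun_prop), lintegral_sub_right_eq_self]
    _ = _ := by rw [lintegral_const_mul _ (by fun_prop), sq, mul_assoc]

/-- A measurable kernel dominated by a convolution kernel. -/
structure KernelBound (K : E → E → ℂ) (A B : E → ℝ) : Prop where
  measurable_kernel : Measurable (Function.uncurry K)
  measurable_left : Measurable A
  measurable_right : Measurable B
  norm_le : ∀ x y, ‖K x y‖ ≤ ‖A (x - y)‖ * ‖B y‖

variable {K : E → E → ℂ} {A B : E → ℝ}

theorem lintegral_enorm_sq_eq {α F : Type*} [MeasurableSpace α] [ENorm F]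
    (ν : Measure α) (f : α → F) : ∫⁻ a, ‖f a‖ₑ ^ 2 ∂ν = eLpNorm f 2 ν ^ 2 := by
  rw [eLpNorm_eq_lintegral_rpow_enorm_toReal (by norm_num) (by norm_num), ← ENNReal.rpow_natCast,
    ← ENNReal.rpow_mul]
  norm_num

/-- The absolute value stays inside the integral, so that the bound serves both the `L²` estimate
and the Fubini argument. -/
theorem KernelBound.eLpNorm_lintegral_le (h : KernelBound K A B) :
    eLpNorm (fun x ↦ ∫⁻ y, ‖K x y‖ₑ) 2 volume ≤ eLpNorm A 1 volume * eLpNorm B 2 volume := by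
  rw [← ENNReal.pow_le_pow_left_iff two_ne_zero, ← lintegral_enorm_sq_eq, mul_pow,
    ← lintegral_enorm_sq_eq, eLpNorm_one_eq_lintegral_enorm]
  refine le_trans (lintegral_mono fun x ↦ ?_)
    (lintegral_sq_convolution_le h.measurable_left.enorm h.measurable_right.enorm)
  simp only [enorm_eq_self]
  gcongr
  rw [← enorm_mul]
  exact enorm_le_iff_norm_le.2 ((h.norm_le _ _).trans_eq (norm_mul _ _).symm)

theorem KernelBound.aestronglyMeasurable_integral (h : KernelBound K A B) :
    AEStronglyMeasurable (fun x ↦ ∫ y, K x y) volume :=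
  (h.measurable_kernel.aestronglyMeasurable (μ := volume.prod volume)).integral_prod_right'

theorem KernelBound.eLpNorm_integral_le (h : KernelBound K A B) :
    eLpNorm (fun x ↦ ∫ y, K x y) 2 volume ≤ eLpNorm A 1 volume * eLpNorm B 2 volume := by
  refine le_trans (eLpNorm_mono_enorm fun x ↦ ?_) h.eLpNorm_lintegral_le
  simpa using enorm_integral_le_lintegral_enorm _

theorem KernelBound.memLp_integral (h : KernelBound K A B) (hA : Integrable A)
    (hB : MemLp B 2 volume) : MemLp (fun x ↦ ∫ y, K x y) 2 volume :=
  ⟨h.aestronglyMeasurable_integral, h.eLpNorm_integral_le.trans_lt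
    (ENNReal.mul_lt_top (memLp_one_iff_integrable.2 hA).2 hB.2)⟩

theorem KernelBound.integrable_integral (h : KernelBound K A B) (hA : Integrable A)
    (hB : Integrable B) : Integrable (fun x ↦ ∫ y, K x y) := by
  have h1 : Integrable (Function.uncurry K) (volume.prod volume) := by
    refine (hB.convolution_integrand (.mul ℝ ℝ) hA).mono
      h.measurable_kernel.aestronglyMeasurable (.of_forall fun z ↦ ?_)
    simpa [mul_comm, Function.uncurry] using h.norm_le z.1 z.2
  exact h1.integral_prod_left

/-- Supplies the absolute convergence behind each use of Fubini when an operator is paired with an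
`L²` function. -/
theorem KernelBound.integrable_mul (h : KernelBound K A B) (hA : Integrable A)
    (hB : MemLp B 2 volume) {ψ : E → ℂ} (hψ : Measurable ψ) (hψ2 : MemLp ψ 2 volume) :
    Integrable (Function.uncurry fun x y ↦ ψ x * K x y) (volume.prod volume) := by
  have hK := h.measurable_kernel
  have hm : Measurable (Function.uncurry fun x y ↦ ψ x * K x y) :=
    (hψ.comp measurable_fst).mul hK
  refine ⟨hm.aestronglyMeasurable, ?_⟩
  rw [HasFiniteIntegral, lintegral_prod _ hm.enorm.aemeasurable]
  have hin : Measurable fun x ↦ ∫⁻ y, ‖K x y‖ₑ := hK.enorm.lintegral_prod_right'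
  have h2 := sq_lintegral_mul_le volume hψ.enorm hin
  have h3 : ∫⁻ x, (∫⁻ y, ‖K x y‖ₑ) ^ 2 < ∞ := by
    have := lintegral_enorm_sq_eq volume fun x ↦ ∫⁻ y, ‖K x y‖ₑ
    simp only [enorm_eq_self] at this
    rw [this]
    exact ENNReal.pow_lt_top (h.eLpNorm_lintegral_le.trans_lt
      (ENNReal.mul_lt_top (memLp_one_iff_integrable.2 hA).2 hB.2))
  have h4 : ∫⁻ x, ‖ψ x‖ₑ ^ 2 < ∞ := by
    rw [lintegral_enorm_sq_eq]
    exact ENNReal.pow_lt_top hψ2.2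
  have h5 : ∫⁻ x, ‖ψ x‖ₑ * ∫⁻ y, ‖K x y‖ₑ < ∞ := by
    have := h2.trans_lt (ENNReal.mul_lt_top h4 h3)
    exact (ENNReal.pow_lt_top_iff.1 this).resolve_right two_ne_zero
  refine lt_of_eq_of_lt (lintegral_congr fun x ↦ ?_) h5
  have : Measurable fun y ↦ ‖K x y‖ₑ := hK.enorm.comp measurable_prodMk_left
  rw [← lintegral_const_mul _ this]
  simp [enorm_mul]

end Kernel

/-! ### Pointwise estimates for the symbol and the logarithmic weights -/

section Symbol

variable {μ : ℝ}

/-- The radial profile of the multiplier `(ln (I - Δ)) ^ μ`. -/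
noncomputable def logPow (μ r : ℝ) : ℝ := Real.log (1 + r ^ 2) ^ μ

theorem log_one_add_sq_nonneg (r : ℝ) : 0 ≤ Real.log (1 + r ^ 2) :=
  Real.log_nonneg (by nlinarith)

theorem logPow_nonneg (μ r : ℝ) : 0 ≤ logPow μ r :=
  Real.rpow_nonneg (log_one_add_sq_nonneg r) μ

theorem logPow_mono (hμ : 0 ≤ μ) {r s : ℝ} (hr : 0 ≤ r) (h : r ≤ s) : logPow μ r ≤ logPow μ s :=
  Real.rpow_le_rpow (log_one_add_sq_nonneg r)
    (Real.log_le_log (by positivity) (by gcongr)) hμ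

theorem hasDerivAt_logPow (μ : ℝ) {t : ℝ} (ht : 0 < t) :
    HasDerivAt (logPow μ) (2 * t / (1 + t ^ 2) * μ * Real.log (1 + t ^ 2) ^ (μ - 1)) t := by
  have h1 : HasDerivAt (fun r : ℝ ↦ 1 + r ^ 2) (2 * t) t := by
    simpa using (hasDerivAt_pow 2 t).const_add 1
  exact (h1.log (by positivity)).rpow_const
    (.inl (Real.log_pos (by nlinarith [pow_pos ht 2])).ne')

/-- The inequality `t² / (1 + t²) ≤ ln(1 + t²)` restores the power of the logarithm lost by
differentiation. It keeps the bound uniform near `0` even for `μ < 1`, where `ln ^ (μ - 1)` is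
singular. -/
theorem mul_deriv_logPow_le (hμ : 0 ≤ μ) {t : ℝ} (ht : 0 < t) :
    t * (2 * t / (1 + t ^ 2) * μ * Real.log (1 + t ^ 2) ^ (μ - 1)) ≤ 2 * μ * logPow μ t := by
  have hL : 0 < Real.log (1 + t ^ 2) := Real.log_pos (by nlinarith [pow_pos ht 2])
  have h1 : t ^ 2 / (1 + t ^ 2) ≤ Real.log (1 + t ^ 2) := by
    have := Real.one_sub_inv_le_log_of_pos (x := 1 + t ^ 2) (by positivity)
    refine le_trans (le_of_eq ?_) this
    field_simp
    ring
  have h2 : logPow μ t = Real.log (1 + t ^ 2) * Real.log (1 + t ^ 2) ^ (μ - 1) := by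
    rw [logPow, Real.rpow_sub_one hL.ne']
    field_simp
  rw [h2]
  calc _ = 2 * μ * (t ^ 2 / (1 + t ^ 2) * Real.log (1 + t ^ 2) ^ (μ - 1)) := by ring
    _ ≤ _ := by gcongr

theorem mul_logPow_sub_le (hμ : 0 ≤ μ) {r s : ℝ} (hr : 0 ≤ r) (hrs : r ≤ s) :
    r * (logPow μ s - logPow μ r) ≤ 2 * μ * (s - r) * logPow μ s := by
  have hs : 0 ≤ 2 * μ * (s - r) * logPow μ s :=
    mul_nonneg (mul_nonneg (by positivity) (by linarith)) (logPow_nonneg μ s)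
  -- `logPow μ` need not be differentiable at `0`; for `r = 0` the left side vanishes. For `r > 0`
  -- the derivative on `(r, s)` is at most `2μ · logPow μ s / r`, and the factor `r` cancels the
  -- denominator.
  rcases hr.eq_or_lt with rfl | hr0
  · simpa using hs
  have key := (convex_Icc r s).image_sub_le_mul_sub_of_deriv_le (f := logPow μ)
    (C := 2 * μ * logPow μ s / r)
    (fun t ht ↦ (hasDerivAt_logPow μ (hr0.trans_le ht.1)).continuousAt.continuousWithinAt)
    (fun t ht ↦ by
      rw [interior_Icc] at ht
      exact (hasDerivAt_logPow μ (hr0.trans ht.1)).differentiableAt.differentiableWithinAt)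
    (fun t ht ↦ by
      rw [interior_Icc] at ht
      have ht0 := hr0.trans ht.1
      rw [(hasDerivAt_logPow μ ht0).deriv, le_div_iff₀ hr0, mul_comm]
      refine le_trans (mul_le_mul_of_nonneg_right ht.1.le ?_)
        ((mul_deriv_logPow_le hμ ht0).trans ?_)
      · have := Real.rpow_nonneg (log_one_add_sq_nonneg t) (μ - 1)
        positivity
      · exact mul_le_mul_of_nonneg_left (logPow_mono hμ ht0.le ht.2.le) (by positivity))
    r (Set.left_mem_Icc.2 hrs) s (Set.right_mem_Icc.2 hrs) hrs
  calc _ ≤ r * (2 * μ * logPow μ s / r * (s - r)) := by gcongr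
    _ = _ := by field_simp

theorem add_three_rpow_le (hμ : 0 ≤ μ) {x y z : ℝ} (hx : 0 ≤ x) (hy : 0 ≤ y) (hz : 0 ≤ z) :
    (x + y + z) ^ μ ≤ 3 ^ μ * (x ^ μ + y ^ μ + z ^ μ) := by
  have hm : 0 ≤ max x (max y z) := hx.trans (le_max_left _ _)
  have h1 : x + y + z ≤ 3 * max x (max y z) := by
    linarith [le_max_left x (max y z), (le_max_left y z).trans (le_max_right x (max y z)),
      (le_max_right y z).trans (le_max_right x (max y z))]
  calc _ ≤ (3 * max x (max y z)) ^ μ := Real.rpow_le_rpow (by positivity) h1 hμ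
    _ = 3 ^ μ * max x (max y z) ^ μ := Real.mul_rpow (by norm_num) hm
    _ ≤ _ := by
      have := Real.rpow_nonneg hx μ
      have := Real.rpow_nonneg hy μ
      have := Real.rpow_nonneg hz μ
      gcongr
      rcases max_choice x (max y z) with h | h
      · rw [h]; linarith
      · rw [h]
        rcases max_choice y z with h | h
        · rw [h]; linarith
        · rw [h]; linarith

/-- Follows from `1 + (a + b)² ≤ 2 (1 + a²) (1 + b²)`: the logarithm turns the product into a sum of
three terms. -/
theorem logPow_add_le (hμ : 0 ≤ μ) (a b : ℝ) :
    logPow μ (a + b) ≤ 3 ^ μ * ((1 + logPow μ a) * (1 + logPow μ b)) := by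
  have h1 : Real.log (1 + (a + b) ^ 2) ≤
      Real.log 2 + Real.log (1 + a ^ 2) + Real.log (1 + b ^ 2) := by
    rw [← Real.log_mul (by norm_num) (by positivity), ← Real.log_mul (by positivity)
      (by positivity)]
    refine Real.log_le_log (by positivity) ?_
    nlinarith [sq_nonneg (a - b), sq_nonneg (a * b)]
  have h2 : Real.log 2 ^ μ ≤ 1 :=
    Real.rpow_le_one (Real.log_nonneg (by norm_num)) (by linarith [Real.log_two_lt_d9]) hμ
  have ha := logPow_nonneg μ a
  have hb := logPow_nonneg μ b
  calc _ ≤ (Real.log 2 + Real.log (1 + a ^ 2) + Real.log (1 + b ^ 2)) ^ μ :=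
        Real.rpow_le_rpow (log_one_add_sq_nonneg _) h1 hμ
    _ ≤ 3 ^ μ * (Real.log 2 ^ μ + logPow μ a + logPow μ b) :=
        add_three_rpow_le hμ (Real.log_nonneg (by norm_num)) (log_one_add_sq_nonneg a)
          (log_one_add_sq_nonneg b)
    _ ≤ _ := by
        gcongr
        nlinarith [mul_nonneg ha hb]

theorem exists_log_rpow_le (hμ : 0 ≤ μ) {ε : ℝ} (hε : 0 < ε) :
    ∃ C : ℝ, 0 < C ∧ ∀ y : ℝ, 1 ≤ y → Real.log y ^ μ ≤ C * y ^ ε := by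
  -- The exponent `ε / (μ + 1)`, raised to the power `μ`, stays below `ε`; the added `1` also covers
  -- `μ = 0`.
  have ht : 0 < ε / (μ + 1) := by positivity
  refine ⟨((ε / (μ + 1)) ^ μ)⁻¹, by positivity, fun y hy ↦ ?_⟩
  have hy0 : 0 ≤ y := by linarith
  calc _ ≤ (y ^ (ε / (μ + 1)) / (ε / (μ + 1))) ^ μ :=
        Real.rpow_le_rpow (Real.log_nonneg hy) (Real.log_le_rpow_div hy0 ht) hμ
    _ = ((ε / (μ + 1)) ^ μ)⁻¹ * y ^ (ε / (μ + 1) * μ) := by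
        rw [Real.div_rpow (by positivity) ht.le, ← Real.rpow_mul hy0]
        ring
    _ ≤ _ := by
        gcongr
        rw [div_mul_eq_mul_div, div_le_iff₀ (by positivity)]
        nlinarith

/-- The weight `1 + (ln (1 + |ξ|²)) ^ μ`. -/
noncomputable def logWeight (μ : ℝ) (ξ : Plane) : ℝ := 1 + logPow μ (2 * Real.pi * ‖ξ‖)

/-- The weight `(1 + |ξ|) (1 + (ln (1 + |ξ|²)) ^ μ)`. -/
noncomputable def linLogWeight (μ : ℝ) (ξ : Plane) : ℝ :=
  (1 + 2 * Real.pi * ‖ξ‖) * logWeight μ ξ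

theorem one_le_logWeight (μ : ℝ) (ξ : Plane) : 1 ≤ logWeight μ ξ :=
  le_add_of_nonneg_right (logPow_nonneg _ _)

theorem logWeight_le_linLogWeight (μ : ℝ) (ξ : Plane) : logWeight μ ξ ≤ linLogWeight μ ξ :=
  le_mul_of_one_le_left (zero_le_one.trans (one_le_logWeight μ ξ))
    (le_add_of_nonneg_right (by positivity))

theorem one_le_linLogWeight (μ : ℝ) (ξ : Plane) : 1 ≤ linLogWeight μ ξ :=
  (one_le_logWeight μ ξ).trans (logWeight_le_linLogWeight μ ξ)

theorem logWeight_neg (μ : ℝ) (ξ : Plane) : logWeight μ (-ξ) = logWeight μ ξ := by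
  simp [logWeight]

theorem linLogWeight_neg (μ : ℝ) (ξ : Plane) : linLogWeight μ (-ξ) = linLogWeight μ ξ := by
  simp [linLogWeight, logWeight_neg]

theorem measurable_logWeight (μ : ℝ) : Measurable (logWeight μ) := by
  unfold logWeight logPow
  fun_prop

theorem measurable_linLogWeight (μ : ℝ) : Measurable (linLogWeight μ) := by
  have := measurable_logWeight μ
  unfold linLogWeight
  fun_prop

theorem measurable_symbol (μ : ℝ) (j : Fin 2) : Measurable (symbol μ j) := by
  unfold symbol
  fun_prop

theorem two_pi_norm_le (ξ η : Plane) :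
    2 * Real.pi * ‖ξ‖ ≤ 2 * Real.pi * ‖ξ - η‖ + 2 * Real.pi * ‖η‖ := by
  rw [← mul_add]
  gcongr
  simpa using norm_add_le (ξ - η) η

theorem logPow_norm_le (hμ : 0 ≤ μ) (ξ η : Plane) :
    logPow μ (2 * Real.pi * ‖ξ‖) ≤ 3 ^ μ * (logWeight μ (ξ - η) * logWeight μ η) :=
  (logPow_mono hμ (by positivity) (two_pi_norm_le ξ η)).trans (logPow_add_le hμ _ _)

theorem norm_two_pi_I_mul_apply_le (ξ : Plane) (j : Fin 2) :
    ‖2 * Real.pi * Complex.I * (ξ j : ℂ)‖ ≤ 2 * Real.pi * ‖ξ‖ := by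
  have := PiLp.norm_apply_le ξ j
  simp only [norm_mul, Complex.norm_I, Complex.norm_real, mul_one, Complex.norm_ofNat]
  rw [Real.norm_of_nonneg Real.pi_pos.le]
  gcongr

theorem norm_symbol_le (μ : ℝ) (j : Fin 2) (ξ : Plane) : ‖symbol μ j ξ‖ ≤ linLogWeight μ ξ := by
  have h := norm_two_pi_I_mul_apply_le ξ j
  have h0 := logPow_nonneg μ (2 * Real.pi * ‖ξ‖)
  have h1 : symbol μ j ξ =
    (logPow μ (2 * Real.pi * ‖ξ‖) : ℂ) * (2 * Real.pi * Complex.I * (ξ j : ℂ)) := rfl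
  rw [h1, norm_mul, Complex.norm_real, Real.norm_of_nonneg h0, linLogWeight, mul_comm, logWeight]
  gcongr
  · linarith
  · linarith

/-- With `L` the logarithmic factor, split `m(ξ) - m(η)` into `L(ξ)` times the linear symbol at `ξ -
η`, plus `L(ξ) - L(η)` times the linear symbol at `η`. In the second term `|η|` is absorbed by
`mul_logPow_sub_le`. -/
theorem norm_symbol_sub_le_of_norm_le (hμ : 0 ≤ μ) (j : Fin 2) {ξ η : Plane} (h : ‖η‖ ≤ ‖ξ‖) :
    ‖symbol μ j ξ - symbol μ j η‖ ≤
      (1 + 2 * μ) * (2 * Real.pi * ‖ξ - η‖) * logPow μ (2 * Real.pi * ‖ξ‖) := by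
  have hle : 2 * Real.pi * ‖η‖ ≤ 2 * Real.pi * ‖ξ‖ := by gcongr
  have h0 := logPow_nonneg μ (2 * Real.pi * ‖ξ‖)
  have h1 := sub_nonneg.2 (logPow_mono hμ (by positivity) hle)
  have h2 := mul_logPow_sub_le hμ (by positivity) hle
  have h3 := norm_two_pi_I_mul_apply_le (ξ - η) j
  have h4 := norm_two_pi_I_mul_apply_le η j
  have h5 : symbol μ j ξ - symbol μ j η =
      (logPow μ (2 * Real.pi * ‖ξ‖) : ℂ) * (2 * Real.pi * Complex.I * ((ξ - η) j : ℂ)) +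
        ((logPow μ (2 * Real.pi * ‖ξ‖) - logPow μ (2 * Real.pi * ‖η‖) : ℝ) : ℂ) *
          (2 * Real.pi * Complex.I * (η j : ℂ)) := by
    have e : ∀ ζ, symbol μ j ζ =
      (logPow μ (2 * Real.pi * ‖ζ‖) : ℂ) * (2 * Real.pi * Complex.I * (ζ j : ℂ)) := fun _ ↦ rfl
    rw [e, e, PiLp.sub_apply]
    push_cast
    ring
  have h6 : 2 * Real.pi * ‖ξ‖ - 2 * Real.pi * ‖η‖ ≤ 2 * Real.pi * ‖ξ - η‖ := by
    linarith [two_pi_norm_le ξ η]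
  rw [h5]
  refine (norm_add_le _ _).trans ?_
  rw [norm_mul (Complex.ofReal _), norm_mul (Complex.ofReal _), Complex.norm_real,
    Complex.norm_real, Real.norm_of_nonneg h0, Real.norm_of_nonneg h1]
  calc _ ≤ logPow μ (2 * Real.pi * ‖ξ‖) * (2 * Real.pi * ‖ξ - η‖) +
        (logPow μ (2 * Real.pi * ‖ξ‖) - logPow μ (2 * Real.pi * ‖η‖)) *
          (2 * Real.pi * ‖η‖) := by gcongr
    _ ≤ logPow μ (2 * Real.pi * ‖ξ‖) * (2 * Real.pi * ‖ξ - η‖) +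
        2 * μ * (2 * Real.pi * ‖ξ - η‖) * logPow μ (2 * Real.pi * ‖ξ‖) := by
      refine add_le_add_right ((mul_comm _ _).trans_le (h2.trans ?_)) _
      gcongr
    _ = _ := by ring

/-- The difference of the symbol at two points. -/
theorem norm_symbol_sub_le (hμ : 0 ≤ μ) (j : Fin 2) (ξ η : Plane) :
    ‖symbol μ j ξ - symbol μ j η‖ ≤
      (1 + 2 * μ) * 3 ^ μ * (linLogWeight μ (ξ - η) * logWeight μ η) := by
  have hv := one_le_logWeight μ (ξ - η)
  have hv' := one_le_logWeight μ η
  suffices h : ‖symbol μ j ξ - symbol μ j η‖ ≤ (1 + 2 * μ) * (2 * Real.pi * ‖ξ - η‖) *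
      (3 ^ μ * (logWeight μ (ξ - η) * logWeight μ η)) by
    refine h.trans ?_
    calc _ = (1 + 2 * μ) * 3 ^ μ *
          (((2 * Real.pi * ‖ξ - η‖) * logWeight μ (ξ - η)) * logWeight μ η) := by ring
      _ ≤ _ := by
        rw [linLogWeight]
        gcongr
        linarith
  rcases le_total ‖η‖ ‖ξ‖ with h | h
  · refine (norm_symbol_sub_le_of_norm_le hμ j h).trans ?_
    gcongr
    exact logPow_norm_le hμ ξ η
  -- With the roles exchanged the logarithm already sits at `η`, so no splitting of frequencies is
  -- needed.
  · rw [norm_sub_rev]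
    refine (norm_symbol_sub_le_of_norm_le hμ j h).trans ?_
    rw [norm_sub_rev η ξ]
    gcongr
    have h3 : (1 : ℝ) ≤ 3 ^ μ := Real.one_le_rpow (by norm_num) hμ
    have h4 : logPow μ (2 * Real.pi * ‖η‖) ≤ logWeight μ η := by
      rw [logWeight]; linarith
    refine h4.trans ?_
    calc logWeight μ η = 1 * (1 * logWeight μ η) := by ring
      _ ≤ _ := by gcongr

/-- A cruder bound without cancellation. It suffices when the variable `η` carries a Schwartz
function, which absorbs the linear weight, and it makes `⟨A f, g φ⟩` converge. -/
theorem norm_symbol_le_mul (hμ : 0 ≤ μ) (j : Fin 2) (ξ η : Plane) :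
    ‖symbol μ j ξ‖ ≤ 2 * 3 ^ μ * (linLogWeight μ (ξ - η) * linLogWeight μ η) := by
  refine (norm_symbol_le μ j ξ).trans ?_
  have hv := one_le_logWeight μ (ξ - η)
  have hv' := one_le_logWeight μ η
  have h3 : (1 : ℝ) ≤ 3 ^ μ := Real.one_le_rpow (by norm_num) hμ
  have h1 : logWeight μ ξ ≤ 2 * 3 ^ μ * (logWeight μ (ξ - η) * logWeight μ η) := by
    have := logPow_norm_le hμ ξ η
    have h4 : (1 : ℝ) ≤ 3 ^ μ * (logWeight μ (ξ - η) * logWeight μ η) :=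
      one_le_mul_of_one_le_of_one_le h3 (one_le_mul_of_one_le_of_one_le hv hv')
    rw [logWeight]
    linarith
  have h2 : 1 + 2 * Real.pi * ‖ξ‖ ≤
      (1 + 2 * Real.pi * ‖ξ - η‖) * (1 + 2 * Real.pi * ‖η‖) := by
    have h5 : 0 ≤ (2 * Real.pi * ‖ξ - η‖) * (2 * Real.pi * ‖η‖) := by positivity
    linarith [two_pi_norm_le ξ η]
  calc linLogWeight μ ξ ≤ ((1 + 2 * Real.pi * ‖ξ - η‖) * (1 + 2 * Real.pi * ‖η‖)) *
        (2 * 3 ^ μ * (logWeight μ (ξ - η) * logWeight μ η)) := by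
        rw [linLogWeight]
        have := one_le_logWeight μ ξ
        gcongr
    _ = _ := by
        rw [linLogWeight, linLogWeight]
        ring

theorem exists_linLogWeight_le (hμ : 0 ≤ μ) {ε : ℝ} (hε : 0 < ε) :
    ∃ C : ℝ, 0 < C ∧ ∀ ξ : Plane,
      linLogWeight μ ξ ≤ C * (1 + (2 * Real.pi * ‖ξ‖) ^ 2) ^ (1 / 2 + ε) := by
  obtain ⟨C, hC, h⟩ := exists_log_rpow_le hμ hε
  refine ⟨2 * (1 + C), by positivity, fun ξ ↦ ?_⟩
  set r := 2 * Real.pi * ‖ξ‖ with hr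
  have hr0 : 0 ≤ r := by positivity
  have h1 : 1 ≤ 1 + r ^ 2 := by nlinarith
  have h2 : 1 + r ≤ 2 * (1 + r ^ 2) ^ (1 / 2 : ℝ) := by
    rw [← Real.sqrt_eq_rpow]
    have : (1 + r) / 2 ≤ √(1 + r ^ 2) := Real.le_sqrt_of_sq_le (by nlinarith [sq_nonneg (r - 1)])
    linarith
  have h3 : logWeight μ ξ ≤ (1 + C) * (1 + r ^ 2) ^ ε := by
    have := Real.one_le_rpow h1 hε.le
    have := h _ h1
    rw [logWeight, logPow, ← hr]
    linarith
  have := one_le_logWeight μ ξ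
  calc linLogWeight μ ξ ≤ (2 * (1 + r ^ 2) ^ (1 / 2 : ℝ)) * ((1 + C) * (1 + r ^ 2) ^ ε) := by
        rw [linLogWeight, ← hr]
        gcongr
    _ = _ := by
        rw [Real.rpow_add (by positivity)]
        ring

/-- With `r = 2π|ξ|` and `y = r ^ δ / (1 + X)` one has `1 + r ^ δ ≤ (1 + X) (1 + y)`, so `ln(1 +
r²)` is bounded by a constant plus multiples of `ln(1 + X)` and `ln(1 + y)`. The `μ`-th power of the
last is at most linear in `y`. The constant does not depend on `X`, which can therefore be adapted
to `f`. -/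
theorem exists_logWeight_le (hμ : 0 ≤ μ) {δ : ℝ} (hδ : 0 < δ) :
    ∃ C : ℝ, 0 < C ∧ ∀ X : ℝ, 0 ≤ X → ∀ ξ : Plane,
      logWeight μ ξ ≤ C * (1 + Real.log (1 + X) ^ μ + (2 * Real.pi * ‖ξ‖) ^ δ / (1 + X)) := by
  obtain ⟨C, hC, h⟩ := exists_log_rpow_le hμ one_pos
  have hl2 : 0 ≤ Real.log 2 := Real.log_nonneg (by norm_num)
  set a := (2 * Real.log 2) ^ μ with ha
  set b := (2 / δ) ^ μ with hb
  have ha0 : 0 ≤ a := by positivity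
  have hb0 : 0 ≤ b := by positivity
  refine ⟨1 + 3 ^ μ * (a + b + b * C), by positivity, fun X hX ξ ↦ ?_⟩
  set r := 2 * Real.pi * ‖ξ‖ with hr
  have hr0 : 0 ≤ r := by positivity
  set y := r ^ δ / (1 + X) with hy
  have hy0 : 0 ≤ y := by positivity
  have hlX : 0 ≤ Real.log (1 + X) := Real.log_nonneg (by linarith)
  have hly : 0 ≤ Real.log (1 + y) := Real.log_nonneg (by linarith)
  have h1 : Real.log (1 + r ^ 2) ≤ 2 * Real.log (1 + r) := by
    rw [← Real.log_rpow (by positivity)]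
    refine Real.log_le_log (by positivity) ?_
    rw [Real.rpow_two]
    nlinarith
  have h2 : Real.log (1 + r) ≤ Real.log 2 + 1 / δ * Real.log (1 + r ^ δ) := by
    rw [← Real.log_rpow (by positivity), ← Real.log_mul (by norm_num) (by positivity)]
    refine Real.log_le_log (by positivity) ?_
    have e1 : r ≤ (1 + r ^ δ) ^ (1 / δ) := by
      calc r = (r ^ δ) ^ (1 / δ) := by
            rw [← Real.rpow_mul hr0, mul_one_div_cancel hδ.ne', Real.rpow_one]
        _ ≤ _ := Real.rpow_le_rpow (by positivity) (by linarith) (by positivity)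
    have e2 : 1 ≤ (1 + r ^ δ) ^ (1 / δ) :=
      Real.one_le_rpow (le_add_of_nonneg_right (by positivity)) (by positivity)
    linarith
  have h3 : Real.log (1 + r ^ δ) ≤ Real.log (1 + X) + Real.log (1 + y) := by
    rw [← Real.log_mul (by positivity) (by positivity)]
    refine Real.log_le_log (by positivity) ?_
    have : (1 + X) * (1 + y) = 1 + X + r ^ δ := by
      rw [hy]
      field_simp
    linarith
  have h4 : Real.log (1 + r ^ 2) ≤
      2 * Real.log 2 + 2 / δ * Real.log (1 + X) + 2 / δ * Real.log (1 + y) := by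
    have : 1 / δ * Real.log (1 + r ^ δ) ≤ 1 / δ * (Real.log (1 + X) + Real.log (1 + y)) := by
      gcongr
    calc _ ≤ 2 * (Real.log 2 + 1 / δ * (Real.log (1 + X) + Real.log (1 + y))) := by linarith
      _ = _ := by ring
  have h5 : logPow μ r ≤ 3 ^ μ * (a + b * Real.log (1 + X) ^ μ + b * Real.log (1 + y) ^ μ) := by
    refine (Real.rpow_le_rpow (log_one_add_sq_nonneg r) h4 hμ).trans
      ((add_three_rpow_le hμ (by positivity) (by positivity) (by positivity)).trans_eq ?_)
    rw [Real.mul_rpow (by positivity) hlX, Real.mul_rpow (by positivity) hly]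
  have h6 : Real.log (1 + y) ^ μ ≤ C * (1 + y) := by
    simpa using h (1 + y) (by linarith)
  have hXμ : 0 ≤ Real.log (1 + X) ^ μ := by positivity
  have h7 : a + b * Real.log (1 + X) ^ μ + b * Real.log (1 + y) ^ μ ≤
      (a + b + b * C) * (1 + Real.log (1 + X) ^ μ + y) := by
    calc _ ≤ a + b * Real.log (1 + X) ^ μ + b * (C * (1 + y)) := by gcongr
      _ ≤ _ := by
        have e : 0 ≤ a * Real.log (1 + X) ^ μ + a * y + b + b * y +
          b * C * Real.log (1 + X) ^ μ := by positivity
        linarith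
  calc logWeight μ ξ = 1 + logPow μ r := rfl
    _ ≤ 1 + 3 ^ μ * ((a + b + b * C) * (1 + Real.log (1 + X) ^ μ + y)) := by
      gcongr
      exact h5.trans (by gcongr)
    _ ≤ _ := by linarith

end Symbol

/-! ### Weighted norms of `ĝ`, `f̂` and Schwartz functions -/

section Weights

open scoped ENNReal

variable {μ : ℝ}

/-- `MemSobolev` gives an `L²` representative only as a tempered distribution; testing against
smooth compactly supported functions identifies it with the pointwise product. -/
theorem memLp_weight_mul_fourier {s : ℝ} {g : L2}
    (hg : TemperedDistribution.MemSobolev s 2 (g : 𝓢'(Plane, ℂ))) :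
    MemLp (fun ξ : Plane ↦ (((1 + ‖ξ‖ ^ 2) ^ (s / 2) : ℝ) : ℂ) * (𝓕 g : L2) ξ) 2 volume := by
  obtain ⟨f', hf'⟩ := TemperedDistribution.memSobolev_iff_exists_smulLeftCLM_fourier.1 hg
  have hw : (fun ξ : Plane ↦ (((1 + ‖ξ‖ ^ 2) ^ (s / 2) : ℝ) : ℂ)).HasTemperateGrowth := by
    fun_prop
  refine (Lp.memLp f').ae_eq ?_
  refine ae_eq_of_integral_contDiff_smul_eq ((Lp.memLp _).locallyIntegrable (by norm_num)) ?_
    fun φ hφ hφc ↦ ?_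
  · exact ((Lp.memLp (𝓕 g : L2)).locallyIntegrable (by norm_num)).continuous_mul
      hw.1.continuous
  · have h₁ : HasCompactSupport (Complex.ofRealCLM ∘ φ) := hφc.comp_left rfl
    have h₂ : ContDiff ℝ (⊤ : ℕ∞) (Complex.ofRealCLM ∘ φ) := by fun_prop
    have key := DFunLike.congr_fun hf' (h₁.toSchwartzMap h₂)
    rw [Lp.fourier_toTemperedDistribution_eq, TemperedDistribution.smulLeftCLM_apply_apply,
      Lp.toTemperedDistribution_apply, Lp.toTemperedDistribution_apply] at key
    simp only [SchwartzMap.smulLeftCLM_apply_apply hw] at key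
    simp only [Complex.real_smul]
    have hcoe : ∀ ξ, h₁.toSchwartzMap h₂ ξ = (φ ξ : ℂ) := fun ξ ↦ by simp
    simp only [smul_eq_mul, hcoe] at key
    rw [← key]
    refine integral_congr_ae (.of_forall fun ξ ↦ ?_)
    simp only
    ring

theorem memLp_sobolev_density {s : ℝ} (hs : 0 ≤ s) {g : L2}
    (hg : TemperedDistribution.MemSobolev s 2 (g : 𝓢'(Plane, ℂ))) :
    MemLp (fun ξ : Plane ↦
      (((1 + (2 * Real.pi * ‖ξ‖) ^ 2) ^ (s / 2) : ℝ) : ℂ) * (𝓕 g : L2) ξ) 2 volume := by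
  have hm := (Lp.stronglyMeasurable (𝓕 g : L2)).measurable
  refine (memLp_weight_mul_fourier hg).of_le_mul (c := ((2 * Real.pi) ^ 2) ^ (s / 2))
    (Measurable.aestronglyMeasurable (by fun_prop)) (.of_forall fun ξ ↦ ?_)
  rw [norm_mul, norm_mul, Complex.norm_real, Complex.norm_real,
    Real.norm_of_nonneg (by positivity), Real.norm_of_nonneg (by positivity), ← mul_assoc,
    ← Real.mul_rpow (by positivity) (by positivity)]
  gcongr
  have : 1 ≤ (2 * Real.pi) ^ 2 := one_le_pow₀ (by linarith [Real.pi_gt_three])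
  rw [mul_pow, mul_add]
  linarith

theorem memLp_rpow_neg {ε : ℝ} (hε : 0 < ε) :
    MemLp (fun ξ : Plane ↦ (1 + (2 * Real.pi * ‖ξ‖) ^ 2) ^ (-(1 + ε) / 2)) 2 volume := by
  rw [memLp_two_iff_integrable_sq (Measurable.aestronglyMeasurable (by fun_prop))]
  have h := integrable_rpow_neg_one_add_norm_sq (E := Plane) (μ := volume) (r := 2 + 2 * ε)
    (by simp; linarith)
  refine h.mono' (Measurable.aestronglyMeasurable (by fun_prop)) (.of_forall fun ξ ↦ ?_)
  rw [Real.norm_of_nonneg (by positivity), ← Real.rpow_natCast, ← Real.rpow_mul (by positivity)]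
  have : 1 ≤ (2 * Real.pi) ^ 2 := one_le_pow₀ (by linarith [Real.pi_gt_three])
  have e : -(1 + ε) / 2 * (2 : ℕ) = -(2 + 2 * ε) / 2 := by push_cast; ring
  rw [e]
  refine Real.rpow_le_rpow_of_nonpos (by positivity) ?_ (by linarith)
  rw [mul_pow]
  nlinarith [sq_nonneg ‖ξ‖]

/-- The weighted `L¹` norm of the Fourier transform is controlled by a Sobolev norm. -/
theorem exists_eLpNorm_linLogWeight_mul_fourier_le (hμ : 0 ≤ μ) {ε : ℝ} (hε : 0 < ε) :
    ∃ C : ℝ, 0 < C ∧ ∀ g : L2,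
      TemperedDistribution.MemSobolev (2 + 3 * ε) 2 (g : 𝓢'(Plane, ℂ)) →
      eLpNorm (fun ξ ↦ linLogWeight μ ξ * ‖(𝓕 g : L2) ξ‖) 1 volume ≤
        ENNReal.ofReal (C * sobolevNorm (2 + 3 * ε) g) := by
  obtain ⟨C, hC, h⟩ := exists_linLogWeight_le hμ hε
  set D := fun ξ : Plane ↦ (1 + (2 * Real.pi * ‖ξ‖) ^ 2) ^ (-(1 + ε) / 2) with hD
  have hD2 : MemLp D 2 volume := memLp_rpow_neg hε
  refine ⟨C * ((eLpNorm D 2 volume).toReal + 1), by positivity, fun g hg ↦ ?_⟩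
  have hS := memLp_sobolev_density (by positivity) hg
  set S := fun ξ : Plane ↦
    (((1 + (2 * Real.pi * ‖ξ‖) ^ 2) ^ ((2 + 3 * ε) / 2) : ℝ) : ℂ) * (𝓕 g : L2) ξ with hSdef
  have h1 : ∀ ξ, ‖linLogWeight μ ξ * ‖(𝓕 g : L2) ξ‖‖ ≤ C * ‖(D • S) ξ‖ := fun ξ ↦ by
    have hp := one_le_linLogWeight μ ξ
    rw [Pi.smul_apply', norm_smul, norm_mul, norm_mul, norm_norm, Complex.norm_real,
      Real.norm_of_nonneg (zero_le_one.trans hp), Real.norm_of_nonneg (by positivity),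
      Real.norm_of_nonneg (by positivity), ← mul_assoc, ← mul_assoc, mul_assoc C,
      ← Real.rpow_add (by positivity)]
    -- This balance accounts for `2 + 3ε`: `1 + ε` for square-integrability of `D` in the plane, `1`
    -- for the derivative and `2ε` for the logarithm.
    have e : -(1 + ε) / 2 + (2 + 3 * ε) / 2 = 1 / 2 + ε := by ring
    rw [e]
    gcongr
    exact h ξ
  have h2 : eLpNorm (D • S) 1 volume ≤ eLpNorm D 2 volume * eLpNorm S 2 volume :=
    eLpNorm_smul_le_mul_eLpNorm hS.1 hD2.1
  calc _ ≤ ENNReal.ofReal C * eLpNorm (D • S) 1 volume :=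
        eLpNorm_le_mul_eLpNorm_of_ae_le_mul (.of_forall h1) 1
    _ ≤ ENNReal.ofReal C * (eLpNorm D 2 volume * eLpNorm S 2 volume) := by gcongr
    _ = ENNReal.ofReal (C * ((eLpNorm D 2 volume).toReal * sobolevNorm (2 + 3 * ε) g)) := by
        rw [ENNReal.ofReal_mul hC.le, ENNReal.ofReal_mul ENNReal.toReal_nonneg,
          ENNReal.ofReal_toReal hD2.2.ne, sobolevNorm, ENNReal.ofReal_toReal hS.2.ne]
    _ ≤ _ := by
        have : 0 ≤ sobolevNorm (2 + 3 * ε) g := ENNReal.toReal_nonneg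
        rw [mul_assoc]
        gcongr
        linarith

/-- The logarithmically weighted `L²` norm of the Fourier transform. -/
theorem exists_eLpNorm_logWeight_mul_fourier_le (hμ : 0 ≤ μ) {δ : ℝ} (hδ : 0 < δ) :
    ∃ C : ℝ, 0 < C ∧ ∀ f : L2, MemHomSobolev δ f →
      eLpNorm (fun ξ ↦ logWeight μ ξ * ‖(𝓕 f : L2) ξ‖) 2 volume ≤
        ENNReal.ofReal (C * (1 + Real.log (1 + homSobolevNorm δ f / ‖f‖) ^ μ) * ‖f‖) := by
  obtain ⟨C, hC, h⟩ := exists_logWeight_le hμ hδ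
  refine ⟨2 * C, by positivity, fun f hf ↦ ?_⟩
  have hN0 : 0 ≤ homSobolevNorm δ f := ENNReal.toReal_nonneg
  set X := homSobolevNorm δ f / ‖f‖ with hX
  have hX0 : 0 ≤ X := by positivity
  have hlog : 0 ≤ Real.log (1 + X) ^ μ :=
    Real.rpow_nonneg (Real.log_nonneg (by linarith)) μ
  -- For `f = 0` the quotient `X` takes the default value `0` and the homogeneous norm vanishes as
  -- well, so this case needs no exception.
  have hN : homSobolevNorm δ f ≤ (1 + X) * ‖f‖ := by
    rcases eq_or_ne f 0 with rfl | hf0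
    · have h0 : (𝓕 (0 : L2) : L2) = 0 := (Lp.fourierTransformₗᵢ Plane ℂ).map_zero
      have : homDensity δ 0 =ᵐ[volume] (0 : Plane → ℂ) := by
        filter_upwards [Lp.coeFn_zero ℂ 2 (volume : Measure Plane)] with ξ hξ
        rw [homDensity, h0, hξ]
        simp
      simp [homSobolevNorm, eLpNorm_congr_ae this]
    · have hf0' : 0 < ‖f‖ := norm_pos_iff.2 hf0
      have : homSobolevNorm δ f = X * ‖f‖ := by rw [hX]; field_simp
      nlinarith
  set F1 : Plane → ℝ := (1 + Real.log (1 + X) ^ μ) • fun ξ ↦ ‖(𝓕 f : L2) ξ‖ with hF1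
  set F2 : Plane → ℝ := (1 + X)⁻¹ • fun ξ ↦ ‖homDensity δ f ξ‖ with hF2
  have hm1 : AEStronglyMeasurable F1 volume :=
    (Lp.aestronglyMeasurable (𝓕 f : L2)).norm.const_smul _
  have hm2 : AEStronglyMeasurable F2 volume := hf.1.norm.const_smul _
  have hpt : ∀ ξ, ‖logWeight μ ξ * ‖(𝓕 f : L2) ξ‖‖ ≤ C * ‖(F1 + F2) ξ‖ := fun ξ ↦ by
    have hv := one_le_logWeight μ ξ
    have hr : 0 ≤ (2 * Real.pi * ‖ξ‖) ^ δ := by positivity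
    have e : (F1 + F2) ξ = (1 + Real.log (1 + X) ^ μ + (2 * Real.pi * ‖ξ‖) ^ δ / (1 + X)) *
        ‖(𝓕 f : L2) ξ‖ := by
      simp only [hF1, hF2, Pi.add_apply, Pi.smul_apply, smul_eq_mul, homDensity, norm_mul, Complex.norm_real,
        Real.norm_of_nonneg hr]
      ring
    rw [e, Real.norm_of_nonneg (by positivity), Real.norm_of_nonneg (by positivity), ← mul_assoc]
    gcongr
    exact h X hX0 ξ
  have hn1 : eLpNorm F1 2 volume = ENNReal.ofReal ((1 + Real.log (1 + X) ^ μ) * ‖f‖) := by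
    rw [hF1, eLpNorm_const_smul, eLpNorm_norm, ENNReal.ofReal_mul (by positivity),
      Real.enorm_of_nonneg (by positivity), ← Lp.norm_fourier_eq f, Lp.norm_def,
      ENNReal.ofReal_toReal (Lp.eLpNorm_ne_top _)]
  have hn2 : eLpNorm F2 2 volume ≤ ENNReal.ofReal ‖f‖ := by
    rw [hF2, eLpNorm_const_smul, eLpNorm_norm, Real.enorm_of_nonneg (by positivity),
      ← ENNReal.ofReal_toReal hf.2.ne, ← ENNReal.ofReal_mul (by positivity)]
    refine ENNReal.ofReal_le_ofReal ?_
    rw [inv_mul_le_iff₀ (by positivity)]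
    exact hN
  calc _ ≤ ENNReal.ofReal C * eLpNorm (F1 + F2) 2 volume :=
        eLpNorm_le_mul_eLpNorm_of_ae_le_mul (.of_forall hpt) 2
    _ ≤ ENNReal.ofReal C *
        (ENNReal.ofReal ((1 + Real.log (1 + X) ^ μ) * ‖f‖) + ENNReal.ofReal ‖f‖) := by
        gcongr
        exact (eLpNorm_add_le hm1 hm2 one_le_two).trans (by rw [hn1]; gcongr)
    _ = ENNReal.ofReal (C * ((1 + Real.log (1 + X) ^ μ) * ‖f‖ + ‖f‖)) := by
        rw [ENNReal.ofReal_mul hC.le, ENNReal.ofReal_add (by positivity) (by positivity)]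
    _ ≤ _ := by
        refine ENNReal.ofReal_le_ofReal ?_
        have : 0 ≤ C * (Real.log (1 + X) ^ μ * ‖f‖) := by positivity
        linarith

theorem memLp_linLogWeight_mul_schwartz (hμ : 0 ≤ μ) (ψ : 𝓢(Plane, ℂ)) (p : ℝ≥0∞) :
    MemLp (fun ξ ↦ linLogWeight μ ξ * ‖ψ ξ‖) p volume := by
  -- The choice `ε = 1 / 2` makes the majorant the polynomial `1 + (2π|ξ|)²`, which preserves
  -- Schwartz functions.
  obtain ⟨C, hC, h⟩ := exists_linLogWeight_le hμ (ε := 1 / 2) (by norm_num)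
  have hw : (fun ξ : Plane ↦ ((1 + (2 * Real.pi) ^ 2 * ‖ξ‖ ^ 2 : ℝ) : ℂ)).HasTemperateGrowth := by
    fun_prop
  refine (SchwartzMap.memLp (SchwartzMap.smulLeftCLM ℂ
    (fun ξ : Plane ↦ ((1 + (2 * Real.pi) ^ 2 * ‖ξ‖ ^ 2 : ℝ) : ℂ)) ψ) p volume).of_le_mul (c := C)
    (((measurable_linLogWeight μ).mul ψ.continuous.measurable.norm).aestronglyMeasurable)
    (.of_forall fun ξ ↦ ?_)
  have hp := one_le_linLogWeight μ ξ
  rw [SchwartzMap.smulLeftCLM_apply_apply hw, norm_smul, norm_mul, norm_norm,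
    Complex.norm_real, Real.norm_of_nonneg (by positivity), Real.norm_of_nonneg (by positivity),
    ← mul_assoc]
  gcongr
  refine (h ξ).trans_eq ?_
  norm_num [mul_pow]

end Weights

/-! ### The two pairings as double integrals, and the commutator kernel -/

section Commutator

open scoped ENNReal

variable {μ : ℝ}

theorem fourier_congr_ae {u v : Plane → ℂ} (h : u =ᵐ[volume] v) : 𝓕 u = 𝓕 v := by
  ext ξ
  rw [Real.fourier_eq, Real.fourier_eq]
  refine integral_congr_ae ?_
  filter_upwards [h] with x hx
  rw [hx]

theorem fourierInv_congr_ae {u v : Plane → ℂ} (h : u =ᵐ[volume] v) : 𝓕⁻ u = 𝓕⁻ v := by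
  ext ξ
  rw [Real.fourierInv_eq, Real.fourierInv_eq]
  refine integral_congr_ae ?_
  filter_upwards [h] with x hx
  rw [hx]

theorem KernelBound.integral_mul_integral {K : Plane → Plane → ℂ} {A B : Plane → ℝ}
    (h : KernelBound K A B) (hA : Integrable A) (hB : MemLp B 2 volume) {ψ : Plane → ℂ}
    (hψ : Measurable ψ) (hψ2 : MemLp ψ 2 volume) :
    ∫ x, ψ x * ∫ y, K x y =
      ∫ z, Function.uncurry (fun x y ↦ ψ x * K x y) z ∂(volume.prod volume) := by
  rw [integral_prod _ (h.integrable_mul hA hB hψ hψ2)]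
  simp only [Function.uncurry, integral_const_mul]

/-- The Fourier transform turns the convolution with `a` into the product with `𝓕 a`. -/
theorem fourier_integral_mul {a ψ : Plane → ℂ} (ha : Integrable a) (hψ : Integrable ψ) :
    𝓕 (fun η ↦ ∫ ξ, a (η - ξ) * ψ ξ) = fun x ↦ 𝓕 a x * 𝓕 ψ x := by
  ext x
  rw [mul_comm, ← Real.fourier_mul_convolution_eq hψ ha]
  refine congrFun (congrArg 𝓕 (funext fun η ↦ ?_)) x
  simp [convolution, mul_comm]

/-- The Fourier side data of a multiplication operator: an integrable function `a`, with a weighted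
integrability, whose Fourier integral is the factor. -/
structure IsFactor (μ : ℝ) (a : Plane → ℂ) : Prop where
  measurable : Measurable a
  integrable_weight : Integrable fun k ↦ linLogWeight μ k * ‖a k‖

namespace IsFactor

variable {a : Plane → ℂ}

theorem integrable (h : IsFactor μ a) : Integrable a := by
  refine h.integrable_weight.mono h.measurable.aestronglyMeasurable (.of_forall fun k ↦ ?_)
  have := one_le_linLogWeight μ k
  rw [norm_mul, norm_norm, Real.norm_of_nonneg (by linarith)]
  exact le_mul_of_one_le_left (norm_nonneg _) this

theorem measurable_weight (h : IsFactor μ a) :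
    Measurable fun k ↦ linLogWeight μ k * ‖a k‖ :=
  (measurable_linLogWeight μ).mul h.measurable.norm

theorem comp_neg (h : IsFactor μ a) : IsFactor μ fun k ↦ a (-k) where
  measurable := h.measurable.comp measurable_neg
  integrable_weight := by simpa only [linLogWeight_neg] using h.integrable_weight.comp_neg

theorem kernelBound_mul (h : IsFactor μ a) (ψ : 𝓢(Plane, ℂ)) :
    KernelBound (fun η ξ ↦ a (η - ξ) * ψ ξ) (fun k ↦ linLogWeight μ k * ‖a k‖)
      (fun ξ ↦ linLogWeight μ ξ * ‖ψ ξ‖) where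
  measurable_kernel := by
    have := h.measurable
    have := ψ.continuous.measurable
    unfold Function.uncurry
    fun_prop
  measurable_left := h.measurable_weight
  measurable_right := (measurable_linLogWeight μ).mul ψ.continuous.measurable.norm
  norm_le η ξ := by
    have h1 := one_le_linLogWeight μ (η - ξ)
    have h2 := one_le_linLogWeight μ ξ
    rw [norm_mul, norm_mul, norm_mul, norm_norm, norm_norm,
      Real.norm_of_nonneg (by linarith), Real.norm_of_nonneg (by linarith)]
    exact mul_le_mul (le_mul_of_one_le_left (norm_nonneg _) h1)
      (le_mul_of_one_le_left (norm_nonneg _) h2) (norm_nonneg _) (by positivity)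

theorem kernelBound_symbol_right (h : IsFactor μ a) (j : Fin 2) (ψ : 𝓢(Plane, ℂ)) :
    KernelBound (fun η ξ ↦ a (η - ξ) * (symbol μ j ξ * ψ ξ))
      (fun k ↦ linLogWeight μ k * ‖a k‖) (fun ξ ↦ linLogWeight μ ξ * ‖ψ ξ‖) where
  measurable_kernel := by
    have := h.measurable
    have := ψ.continuous.measurable
    have := measurable_symbol μ j
    unfold Function.uncurry
    fun_prop
  measurable_left := h.measurable_weight
  measurable_right := (measurable_linLogWeight μ).mul ψ.continuous.measurable.norm
  norm_le η ξ := by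
    have h1 := one_le_linLogWeight μ (η - ξ)
    have h2 := one_le_linLogWeight μ ξ
    rw [norm_mul, norm_mul, norm_mul, norm_mul, norm_norm, norm_norm,
      Real.norm_of_nonneg (by linarith), Real.norm_of_nonneg (by linarith)]
    exact mul_le_mul (le_mul_of_one_le_left (norm_nonneg _) h1)
      (mul_le_mul_of_nonneg_right (norm_symbol_le μ j ξ) (norm_nonneg _)) (by positivity)
      (by positivity)

theorem kernelBound_symbol_left (h : IsFactor μ a) (hμ : 0 ≤ μ) (j : Fin 2) (ψ : 𝓢(Plane, ℂ)) :
    KernelBound (fun η ξ ↦ symbol μ j η * (a (η - ξ) * ψ ξ))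
      (fun k ↦ 2 * 3 ^ μ * (linLogWeight μ k * ‖a k‖))
      (fun ξ ↦ linLogWeight μ ξ * ‖ψ ξ‖) where
  measurable_kernel := by
    have := h.measurable
    have := ψ.continuous.measurable
    have := measurable_symbol μ j
    unfold Function.uncurry
    fun_prop
  measurable_left := h.measurable_weight.const_mul _
  measurable_right := (measurable_linLogWeight μ).mul ψ.continuous.measurable.norm
  norm_le η ξ := by
    have h1 := one_le_linLogWeight μ (η - ξ)
    have h2 := one_le_linLogWeight μ ξ
    have h3 := norm_symbol_le_mul hμ j η ξ
    rw [Real.norm_of_nonneg (by positivity), Real.norm_of_nonneg (by positivity), norm_mul,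
      norm_mul]
    calc _ ≤ 2 * 3 ^ μ * (linLogWeight μ (η - ξ) * linLogWeight μ ξ) *
          (‖a (η - ξ)‖ * ‖ψ ξ‖) := by gcongr
      _ = _ := by ring

theorem kernelBound_commutator (h : IsFactor μ a) (hμ : 0 ≤ μ) (j : Fin 2) {u : Plane → ℂ}
    (hu : Measurable u) :
    KernelBound (fun ξ η ↦ a (ξ - η) * ((symbol μ j ξ - symbol μ j η) * u η))
      (fun k ↦ (1 + 2 * μ) * 3 ^ μ * (linLogWeight μ k * ‖a k‖))
      (fun ξ ↦ logWeight μ ξ * ‖u ξ‖) where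
  measurable_kernel := by
    have := h.measurable
    have := measurable_symbol μ j
    unfold Function.uncurry
    fun_prop
  measurable_left := h.measurable_weight.const_mul _
  measurable_right := (measurable_logWeight μ).mul hu.norm
  norm_le ξ η := by
    have h1 := one_le_linLogWeight μ (ξ - η)
    have h2 := one_le_logWeight μ η
    have h3 := norm_symbol_sub_le hμ j ξ η
    rw [Real.norm_of_nonneg (by positivity), Real.norm_of_nonneg (by positivity), norm_mul,
      norm_mul]
    calc _ ≤ ‖a (ξ - η)‖ * ((1 + 2 * μ) * 3 ^ μ *
          (linLogWeight μ (ξ - η) * logWeight μ η) * ‖u η‖) := by gcongr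
      _ = _ := by ring

end IsFactor

theorem integrable_schwartz_weight (hμ : 0 ≤ μ) (ψ : 𝓢(Plane, ℂ)) :
    Integrable fun ξ ↦ linLogWeight μ ξ * ‖ψ ξ‖ :=
  memLp_one_iff_integrable.1 (memLp_linLogWeight_mul_schwartz hμ ψ 1)

theorem memLp_symbol_mul_schwartz (hμ : 0 ≤ μ) (j : Fin 2) (ψ : 𝓢(Plane, ℂ)) (p : ℝ≥0∞) :
    MemLp (fun ξ ↦ symbol μ j ξ * ψ ξ) p volume := by
  refine (memLp_linLogWeight_mul_schwartz hμ ψ p).mono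
    ((measurable_symbol μ j).mul ψ.continuous.measurable).aestronglyMeasurable
    (.of_forall fun ξ ↦ ?_)
  have := one_le_linLogWeight μ ξ
  rw [norm_mul, norm_mul, norm_norm, Real.norm_of_nonneg (by linarith)]
  gcongr
  exact norm_symbol_le μ j ξ

theorem integrable_symbol_mul_schwartz (hμ : 0 ≤ μ) (j : Fin 2) (ψ : 𝓢(Plane, ℂ)) :
    Integrable fun ξ ↦ symbol μ j ξ * ψ ξ :=
  memLp_one_iff_integrable.1 (memLp_symbol_mul_schwartz hμ j ψ 1)

theorem coe_eq_fourier_fourierInv (φ : 𝓢(Plane, ℂ)) :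
    (φ : Plane → ℂ) = 𝓕 ((𝓕⁻ φ : 𝓢(Plane, ℂ)) : Plane → ℂ) := by
  rw [← SchwartzMap.fourier_coe, FourierTransform.fourier_fourierInv_eq]

theorem transposeOp_schwartz (μ : ℝ) (j : Fin 2) (φ : 𝓢(Plane, ℂ)) :
    transposeOp μ j φ = 𝓕 (fun ξ ↦ symbol μ j ξ * (𝓕⁻ φ : 𝓢(Plane, ℂ)) ξ) := by
  rw [transposeOp, SchwartzMap.fourierInv_coe]

variable {a : Plane → ℂ} {g f : L2}

/-- For `g = 𝓕 a`, the inverse Fourier transform of `g φ` is a convolution. -/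
theorem fourierInv_mul_ae_eq (ha : IsFactor μ a) (hμ : 0 ≤ μ) (hg : g =ᵐ[volume] 𝓕 a)
    (φ : 𝓢(Plane, ℂ)) :
    𝓕⁻ (fun x ↦ g x * φ x) =ᵐ[volume]
      fun η ↦ ∫ ξ, a (η - ξ) * (𝓕⁻ φ : 𝓢(Plane, ℂ)) ξ := by
  set ψ : 𝓢(Plane, ℂ) := 𝓕⁻ φ
  have hK := ha.kernelBound_mul ψ
  have h1 := hK.integrable_integral ha.integrable_weight (integrable_schwartz_weight hμ ψ)
  have h2 := hK.memLp_integral ha.integrable_weight (memLp_linLogWeight_mul_schwartz hμ ψ 2)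
  have h3 : (fun x ↦ g x * φ x) =ᵐ[volume] 𝓕 (fun η ↦ ∫ ξ, a (η - ξ) * ψ ξ) := by
    rw [fourier_integral_mul ha.integrable ψ.integrable, ← coe_eq_fourier_fourierInv]
    filter_upwards [hg] with x hx
    rw [hx]
  have h4 : Integrable (fun x ↦ g x * φ x) := (Lp.memLp g).integrable_mul (φ.memLp 2)
  rw [fourierInv_congr_ae h3]
  exact fourierInv_fourier_ae_eq h1 h2 (h4.congr h3)

theorem symbol_mul_fourierInv_mul_ae_eq (ha : IsFactor μ a) (hμ : 0 ≤ μ)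
    (hg : g =ᵐ[volume] 𝓕 a) (j : Fin 2) (φ : 𝓢(Plane, ℂ)) :
    (fun η ↦ symbol μ j η * (𝓕⁻ (fun x ↦ g x * φ x) : Plane → ℂ) η) =ᵐ[volume]
      fun η ↦ ∫ ξ, symbol μ j η * (a (η - ξ) * (𝓕⁻ φ : 𝓢(Plane, ℂ)) ξ) := by
  filter_upwards [fourierInv_mul_ae_eq ha hμ hg φ] with η hη
  rw [hη, integral_const_mul]

/-- Since `g = 𝓕 a`, the factor `g` moves onto the transposed operator: `𝓕 a · 𝓕 (m ψ)` is the
transform of the convolution of `a` with `m ψ`, where `ψ = 𝓕⁻ φ`. Here the symbol is evaluated at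
the inner variable. -/
theorem canPair_mul (ha : IsFactor μ a) (hμ : 0 ≤ μ) (hg : g =ᵐ[volume] 𝓕 a) (j : Fin 2)
    (f : L2) (φ : 𝓢(Plane, ℂ)) :
    CanPair μ j (fun x ↦ f x * g x) φ ∧
      pairing μ j (fun x ↦ f x * g x) φ =
        ∫ η, (𝓕 f : L2) η *
          ∫ ξ, a (η - ξ) * (symbol μ j ξ * (𝓕⁻ φ : 𝓢(Plane, ℂ)) ξ) := by
  have hT := transposeOp_schwartz μ j φ
  have hφ : (𝓕⁻ (φ : Plane → ℂ) : Plane → ℂ) = (𝓕⁻ φ : 𝓢(Plane, ℂ)) :=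
    (SchwartzMap.fourierInv_coe φ).symm
  set ψ : 𝓢(Plane, ℂ) := 𝓕⁻ φ
  have hK := ha.kernelBound_symbol_right j ψ
  have h1 := hK.integrable_integral ha.integrable_weight (integrable_schwartz_weight hμ ψ)
  have h2 := hK.memLp_integral ha.integrable_weight (memLp_linLogWeight_mul_schwartz hμ ψ 2)
  have h3 : (fun x ↦ f x * g x * transposeOp μ j φ x) =ᵐ[volume]
      fun x ↦ f x * 𝓕 (fun η ↦ ∫ ξ, a (η - ξ) * (symbol μ j ξ * ψ ξ)) x := by
    rw [fourier_integral_mul ha.integrable (integrable_symbol_mul_schwartz hμ j ψ), hT]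
    filter_upwards [hg] with x hx
    rw [hx, mul_assoc]
  refine ⟨⟨φ.integrable, ?_, ?_⟩, ?_⟩
  · rw [hφ]
    exact integrable_symbol_mul_schwartz hμ j ψ
  · exact ((Lp.memLp f).integrable_mul (memLp_two_fourier h1 h2)).congr h3.symm
  · rw [pairing, integral_congr_ae h3, integral_mul_fourier_eq f h1 h2]

/-- Now `g` multiplies the test function before the operator acts, so the symbol is evaluated at the
outer variable; its difference with `canPair_mul` yields `m(ξ) - m(η)`. -/
theorem canPair_left (ha : IsFactor μ a) (hμ : 0 ≤ μ) (hg : g =ᵐ[volume] 𝓕 a) (j : Fin 2)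
    (f : L2) (φ : 𝓢(Plane, ℂ)) :
    CanPair μ j f (fun x ↦ g x * φ x) ∧
      pairing μ j f (fun x ↦ g x * φ x) =
        ∫ η, (𝓕 f : L2) η *
          ∫ ξ, symbol μ j η * (a (η - ξ) * (𝓕⁻ φ : 𝓢(Plane, ℂ)) ξ) := by
  have hae := symbol_mul_fourierInv_mul_ae_eq ha hμ hg j φ
  have hT : transposeOp μ j (fun x ↦ g x * φ x) = _ := fourier_congr_ae hae
  set ψ : 𝓢(Plane, ℂ) := 𝓕⁻ φ
  have hK := ha.kernelBound_symbol_left hμ j ψ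
  have hA := ha.integrable_weight.const_mul (2 * 3 ^ μ)
  have h1 := hK.integrable_integral hA (integrable_schwartz_weight hμ ψ)
  have h2 := hK.memLp_integral hA (memLp_linLogWeight_mul_schwartz hμ ψ 2)
  refine ⟨⟨(Lp.memLp g).integrable_mul (φ.memLp 2), h1.congr hae.symm, ?_⟩, ?_⟩
  · rw [hT]
    exact (Lp.memLp f).integrable_mul (memLp_two_fourier h1 h2)
  · rw [pairing, hT, integral_mul_fourier_eq f h1 h2]

/-- The Fourier transform of the commutator is the integral of the commutator kernel. -/
theorem exists_isCommutator (ha : IsFactor μ a) (hμ : 0 ≤ μ) (hg : g =ᵐ[volume] 𝓕 a)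
    (j : Fin 2) (hf : MemLp (fun ξ ↦ logWeight μ ξ * ‖(𝓕 f : L2) ξ‖) 2 volume) :
    ∃ h : L2, IsCommutator μ j g f h ∧
      ENNReal.ofReal ‖h‖ ≤
        ENNReal.ofReal ((1 + 2 * μ) * 3 ^ μ) *
          eLpNorm (fun k ↦ linLogWeight μ k * ‖a (-k)‖) 1 volume *
          eLpNorm (fun ξ ↦ logWeight μ ξ * ‖(𝓕 f : L2) ξ‖) 2 volume := by
  have hfm := (Lp.stronglyMeasurable (𝓕 f : L2)).measurable
  have hK := ha.comp_neg.kernelBound_commutator hμ j hfm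
  have hA := ha.comp_neg.integrable_weight.const_mul ((1 + 2 * μ) * 3 ^ μ)
  have hH := hK.memLp_integral hA hf
  -- The witness is the inverse transform of the kernel integral. As `g = 𝓕 a`, its kernel involves
  -- `ĝ(k) = a(-k)`.
  refine ⟨𝓕⁻ (hH.toLp _), ⟨fun φ ↦ (canPair_mul ha hμ hg j f φ).1,
    fun φ ↦ (canPair_left ha hμ hg j f φ).1, fun φ ↦ ?_⟩, ?_⟩
  · rw [(canPair_mul ha hμ hg j f φ).2, (canPair_left ha hμ hg j f φ).2]
    have hφ := coe_eq_fourier_fourierInv φ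
    set ψ : 𝓢(Plane, ℂ) := 𝓕⁻ φ
    have hB := memLp_linLogWeight_mul_schwartz hμ ψ 2
    have hR := ha.kernelBound_symbol_right j ψ
    have hL := ha.kernelBound_symbol_left hμ j ψ
    have hAL := ha.integrable_weight.const_mul (2 * 3 ^ μ)
    rw [hR.integral_mul_integral ha.integrable_weight hB hfm (Lp.memLp _),
      hL.integral_mul_integral hAL hB hfm (Lp.memLp _),
      ← integral_sub (hR.integrable_mul ha.integrable_weight hB hfm (Lp.memLp _))
        (hL.integrable_mul hAL hB hfm (Lp.memLp _)), hφ,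
      integral_mul_fourier_eq _ ψ.integrable (ψ.memLp 2),
      FourierTransform.fourier_fourierInv_eq]
    calc _ = ∫ ξ, ψ ξ * ∫ η, a (-(ξ - η)) * ((symbol μ j ξ - symbol μ j η) * (𝓕 f : L2) η) := by
          refine integral_congr_ae ?_
          filter_upwards [hH.coeFn_toLp] with ξ hξ
          rw [hξ, mul_comm]
      _ = _ := by
          rw [hK.integral_mul_integral hA hf ψ.continuous.measurable (ψ.memLp 2),
            -- Exchanging `ξ` and `η` matches the two double integrals, since `a(-(ξ - η)) = a(η -
            -- ξ)`.
            ← integral_prod_swap]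
          refine integral_congr_ae (.of_forall fun z ↦ ?_)
          simp only [Function.uncurry, Prod.fst_swap, Prod.snd_swap, neg_sub]
          ring
  · have hnorm : ‖(𝓕⁻ (hH.toLp _) : L2)‖ = ‖(hH.toLp _ : L2)‖ :=
      (Lp.fourierTransformₗᵢ Plane ℂ).symm.norm_map _
    rw [hnorm, Lp.norm_toLp, ENNReal.ofReal_toReal hH.2.ne]
    refine hK.eLpNorm_integral_le.trans_eq ?_
    congr 1
    have e := eLpNorm_const_smul ((1 + 2 * μ) * 3 ^ μ)
      (fun k ↦ linLogWeight μ k * ‖a (-k)‖) 1 (volume : Measure Plane)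
    rw [Real.enorm_of_nonneg (by positivity)] at e
    exact e

end Commutator

end LogCommutator

/-! ### Assembly of the commutator estimate -/

theorem mainTheorem5 (μ δ ε : ℝ) (hμ : 0 ≤ μ) (hδ : 0 < δ) (hε : 0 < ε) :
    ∃ C : ℝ, 0 < C ∧
      ∀ (j : Fin 2) (f g : LogCommutator.L2),
        LogCommutator.MemHomSobolev δ f →
        TemperedDistribution.MemSobolev (2 + 3 * ε) 2 (g : 𝓢'(LogCommutator.Plane, ℂ)) →
        ∃ h : LogCommutator.L2,
          LogCommutator.IsCommutator μ j g f h ∧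
          ‖h‖ ≤ C * (1 + Real.log (1 + LogCommutator.homSobolevNorm δ f / ‖f‖) ^ μ) * ‖f‖ *
            LogCommutator.sobolevNorm (2 + 3 * ε) g := by
  obtain ⟨C₁, hC₁, h₁⟩ := LogCommutator.exists_eLpNorm_linLogWeight_mul_fourier_le hμ hε
  obtain ⟨C₂, hC₂, h₂⟩ := LogCommutator.exists_eLpNorm_logWeight_mul_fourier_le hμ hδ
  refine ⟨(1 + 2 * μ) * 3 ^ μ * C₁ * C₂, by positivity, fun j f g hf hg ↦ ?_⟩
  have hgm := (Lp.stronglyMeasurable (𝓕 g : LogCommutator.L2)).measurable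
  have hfm := (Lp.stronglyMeasurable (𝓕 f : LogCommutator.L2)).measurable
  have ha : LogCommutator.IsFactor μ (𝓕 g : LogCommutator.L2) :=
    ⟨hgm, memLp_one_iff_integrable.1
      ⟨((LogCommutator.measurable_linLogWeight μ).mul hgm.norm).aestronglyMeasurable,
        (h₁ g hg).trans_lt ENNReal.ofReal_lt_top⟩⟩
  have hfL : MemLp (fun ξ ↦ LogCommutator.logWeight μ ξ * ‖(𝓕 f : LogCommutator.L2) ξ‖) 2 volume :=
    ⟨((LogCommutator.measurable_logWeight μ).mul hfm.norm).aestronglyMeasurable,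
      (h₂ f hf).trans_lt ENNReal.ofReal_lt_top⟩
  -- Inversion gives `g = 𝓕 (ĝ(-·))`, so the factor is `a = ĝ(-·)`; the reflection in the norm bound
  -- turns it back into `ĝ`.
  obtain ⟨h, hcomm, hle⟩ := LogCommutator.exists_isCommutator ha.comp_neg hμ
    (LogCommutator.ae_eq_fourier_of_integrable g ha.integrable) j hfL
  refine ⟨h, hcomm, ?_⟩
  simp only [neg_neg] at hle
  have hs : 0 ≤ LogCommutator.sobolevNorm (2 + 3 * ε) g := ENNReal.toReal_nonneg
  have hX : 0 ≤ LogCommutator.homSobolevNorm δ f / ‖f‖ :=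
    div_nonneg ENNReal.toReal_nonneg (norm_nonneg _)
  have hlog : 0 ≤ Real.log (1 + LogCommutator.homSobolevNorm δ f / ‖f‖) ^ μ :=
    Real.rpow_nonneg (Real.log_nonneg (by linarith)) μ
  have key := hle.trans (mul_le_mul' (mul_le_mul' le_rfl (h₁ g hg)) (h₂ f hf))
  rw [← ENNReal.ofReal_mul (by positivity), ← ENNReal.ofReal_mul (by positivity),
    ENNReal.ofReal_le_ofReal_iff (by positivity)] at key
  exact key.trans_eq (by ring)
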